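/- Let $n,p$ be integers with $p\ge 0$ and $n-p-2>0$, let $X\in\mathbb R^{n\times p}$ be a fixed matrix of rank $p$, and consider the linear regression model $y\sim \mathrm N_n(X\beta,\sigma^2 I_n)$ with unknown $\beta\in\mathbb R^p$ and $\sigma^2>0$. Let $p(y\mid\beta,\sigma^2)$ be the density of $y$ and let $$\hat\beta=(X^\top X)^{-1}X^\top y,\qquad \hat\sigma^2=\|y-X\hat\beta\|^2/n,\qquad d=d\big((\beta,\sigma^2),(\hat\beta,\hat\sigma^2)\big)=-2\int p(\tilde y\mid\beta,\sigma^2)\log p(\tilde y\mid\hat\beta,\hat\sigma^2)\,d\tilde y ,$$ $$\mathrm{AICc}=n\log(2\pi)+n\log\hat\sigma^2+\frac{n(n+p)}{n-p-2}=-2\log p(y\mid\hat\beta,\hat\sigma^2)+\frac{2n(p+1)}{n-p-2},\qquad \bar c=\frac{4n^2(p-4)}{(n-p)(n-p+2)} .$$ The risk of an estimator $\lambda(y)$ of the Kullback--Leibler discrepancy $d$ is $\mathrm E_{\beta,\sigma^2}[(\lambda(y)-d)^2]\in[0,\infty]$. An estimator $\lambda_1$ dominates $\lambda_2$ if its risk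 is at most that of $\lambda_2$ for every $(\beta,\sigma^2)$ and strictly smaller for at least one $(\beta,\sigma^2)$; $\lambda$ is inadmissible if some (measurable) estimator dominates it. Then $\bar c>0$ if and only if $p\ge5$. If $\bar c>0$, then $\mathrm{AICc}$ is inadmissible as an estimator of $d$, and for every $c\in(0,\bar c]$ the estimator $$\mathrm{MAICc}=\mathrm{AICc}-c\,\hat\sigma^2\,\|X\hat\beta\|^{-2}$$ satisfies the following. 1. For every $(\beta,\sigma^2)$, the difference of squared errors $(\mathrm{MAICc}-d)^2-(\mathrm{AICc}-d)^2$ is integrable and $$\mathrm E_{\beta,\sigma^2}\big[(\mathrm{MAICc}-d)^2-(\mathrm{AICc}-d)^2\big]\le 0,$$ with strict inequality for at least one $(\beta,\sigma^2)$. 2. If moreover $n-p>4$, then $\mathrm{MAICc}$ dominates $\mathrm{AICc}$ as an estimator of $d$. -/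

import Mathlib

open MeasureTheory ProbabilityTheory
open scoped ENNReal Matrix

namespace LinReg

/-- The mean vector `X β` of the regression model, as a point of Euclidean space. -/
noncomputable def fit {n p : ℕ} (X : Matrix (Fin n) (Fin p) ℝ) (β : Fin p → ℝ) :
    EuclideanSpace ℝ (Fin n) :=
  WithLp.toLp 2 (X *ᵥ β)

/-- The law `N_n(X β, σ² I_n)` of the observation `y`; the argument `s` is `σ²`. -/
noncomputable def law {n p : ℕ} (X : Matrix (Fin n) (Fin p) ℝ) (β : Fin p → ℝ) (s : ℝ) :
    Measure (EuclideanSpace ℝ (Fin n)) :=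
  multivariateGaussian (fit X β) (s • (1 : Matrix (Fin n) (Fin n) ℝ))

/-- The Lebesgue density `p(y ∣ β, σ²)` of `N_n(X β, σ² I_n)`; the argument `s` is `σ²`. -/
noncomputable def density {n p : ℕ} (X : Matrix (Fin n) (Fin p) ℝ) (β : Fin p → ℝ) (s : ℝ)
    (y : EuclideanSpace ℝ (Fin n)) : ℝ :=
  (2 * Real.pi * s) ^ (-(n : ℝ) / 2) * Real.exp (-‖y - fit X β‖ ^ 2 / (2 * s))

/-- The maximum likelihood estimate `β̂ = (XᵀX)⁻¹ Xᵀ y`. -/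
noncomputable def betaHat {n p : ℕ} (X : Matrix (Fin n) (Fin p) ℝ)
    (y : EuclideanSpace ℝ (Fin n)) : Fin p → ℝ :=
  (Xᵀ * X)⁻¹ *ᵥ (Xᵀ *ᵥ y.ofLp)

/-- The maximum likelihood estimate `σ̂² = ‖y - X β̂‖² / n`. -/
noncomputable def sigmaSqHat {n p : ℕ} (X : Matrix (Fin n) (Fin p) ℝ)
    (y : EuclideanSpace ℝ (Fin n)) : ℝ :=
  ‖y - fit X (betaHat X y)‖ ^ 2 / n

/-- The Kullback-Leibler discrepancy
`d((β, σ²), (b, t)) = -2 ∫ p(ỹ ∣ β, σ²) log p(ỹ ∣ b, t) dỹ`. -/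
noncomputable def discrepancy {n p : ℕ} (X : Matrix (Fin n) (Fin p) ℝ)
    (β : Fin p → ℝ) (s : ℝ) (b : Fin p → ℝ) (t : ℝ) : ℝ :=
  -2 * ∫ z : EuclideanSpace ℝ (Fin n), density X β s z * Real.log (density X b t z)

/-- The random loss `d((β, σ²), (β̂(y), σ̂²(y)))` which is to be estimated. -/
noncomputable def loss {n p : ℕ} (X : Matrix (Fin n) (Fin p) ℝ) (β : Fin p → ℝ) (s : ℝ)
    (y : EuclideanSpace ℝ (Fin n)) : ℝ :=
  discrepancy X β s (betaHat X y) (sigmaSqHat X y)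

/-- `AICc = n log(2π) + n log σ̂² + n(n+p)/(n-p-2)`.  When `σ̂² > 0` this is
`-2 log p(y ∣ β̂, σ̂²) + 2n(p+1)/(n-p-2)`, because `-2 log p(y ∣ β̂, σ̂²)` is
`n log(2π) + n log σ̂² + n`. -/
noncomputable def AICc {n p : ℕ} (X : Matrix (Fin n) (Fin p) ℝ)
    (y : EuclideanSpace ℝ (Fin n)) : ℝ :=
  n * Real.log (2 * Real.pi) + n * Real.log (sigmaSqHat X y)
    + (n : ℝ) * ((n : ℝ) + p) / ((n : ℝ) - p - 2)

/-- `MAICc = AICc - c σ̂² ‖X β̂‖⁻²`. -/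
noncomputable def MAICc {n p : ℕ} (X : Matrix (Fin n) (Fin p) ℝ) (c : ℝ)
    (y : EuclideanSpace ℝ (Fin n)) : ℝ :=
  AICc X y - c * sigmaSqHat X y * (‖fit X (betaHat X y)‖ ^ 2)⁻¹

/-- `c̄ = 4n²(p-4) / ((n-p)(n-p+2))`. -/
noncomputable def cBar (n p : ℕ) : ℝ :=
  4 * (n : ℝ) ^ 2 * ((p : ℝ) - 4) / (((n : ℝ) - p) * ((n : ℝ) - p + 2))

/-- The mean squared error `E_{β,σ²}[(l(y) - d)²]` of a loss estimator `l`, with value `∞` when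
the squared error is not integrable. -/
noncomputable def risk {n p : ℕ} (X : Matrix (Fin n) (Fin p) ℝ)
    (l : EuclideanSpace ℝ (Fin n) → ℝ) (β : Fin p → ℝ) (s : ℝ) : ℝ≥0∞ :=
  ∫⁻ y, ENNReal.ofReal ((l y - loss X β s y) ^ 2) ∂(law X β s)

/-- The loss estimator `l₁` dominates `l₂`: its risk is nowhere larger and somewhere smaller. -/
def Dominates {n p : ℕ} (X : Matrix (Fin n) (Fin p) ℝ)
    (l₁ l₂ : EuclideanSpace ℝ (Fin n) → ℝ) : Prop :=
  (∀ (β : Fin p → ℝ) (s : ℝ), 0 < s → risk X l₁ β s ≤ risk X l₂ β s) ∧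
    ∃ (β : Fin p → ℝ) (s : ℝ), 0 < s ∧ risk X l₁ β s < risk X l₂ β s

/-- `l` is inadmissible: some (measurable) loss estimator dominates it. -/
def Inadmissible {n p : ℕ} (X : Matrix (Fin n) (Fin p) ℝ)
    (l : EuclideanSpace ℝ (Fin n) → ℝ) : Prop :=
  ∃ l' : EuclideanSpace ℝ (Fin n) → ℝ, Measurable l' ∧ Dominates X l' l

/-- Domination stated for the difference of the squared errors, which is meaningful also when the
two risks are infinite: `(l₁ - d)² - (l₂ - d)²` is always integrable with expectation at most `0`,
and its expectation is negative for at least one parameter. -/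
def DominatesInDifference {n p : ℕ} (X : Matrix (Fin n) (Fin p) ℝ)
    (l₁ l₂ : EuclideanSpace ℝ (Fin n) → ℝ) : Prop :=
  (∀ (β : Fin p → ℝ) (s : ℝ), 0 < s →
    Integrable (fun y => (l₁ y - loss X β s y) ^ 2 - (l₂ y - loss X β s y) ^ 2) (law X β s) ∧
    ∫ y, ((l₁ y - loss X β s y) ^ 2 - (l₂ y - loss X β s y) ^ 2) ∂(law X β s) ≤ 0) ∧
  ∃ (β : Fin p → ℝ) (s : ℝ), 0 < s ∧
    ∫ y, ((l₁ y - loss X β s y) ^ 2 - (l₂ y - loss X β s y) ^ 2) ∂(law X β s) < 0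

end LinReg

/-! The noise splits into independent standard Gaussian parts `x` in the column space `V` (dimension
`p`) and `w` in its orthogonal complement `W` (dimension `m = n - p`). With `ν = Xβ/σ`, almost
surely `AICc - d = n(n+p)/(m-2) - n(n + ‖x‖²)/‖w‖²`, and `MAICc` subtracts `(c/n) ‖w‖²/‖x+ν‖²`. In
the difference of squared errors the correction multiplies `AICc - d`, so the factor `‖w‖²` cancels
the singular `‖w‖⁻²`. What remains (`errorDiff`) needs only polynomial moments of `w` and inverse
moments of `x+ν`, which explains its integrability even when both risks are infinite.

Put `a = E‖x+ν‖⁻²`, `b = E‖x+ν‖⁻⁴`, `e = E[‖x‖²/‖x+ν‖²]`. Two applications of Stein's identity give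
`e ≤ p a - 2(p-4) b` (`integral_inv_norm_sq_mul_norm_sq_le`). Together with `E‖w‖² = m` and `E‖w‖⁴ =
m(m+2)`, the expected difference is at most `c b (c m(m+2)/n² - 4(p-4)) - 4c(n+p)a/(m-2)`. The first
term is nonpositive exactly when `c ≤ c̄` (as `b > 0`), and the second is negative since `a > 0`
(`integral_errorDiff_neg`).

Passing to risks requires finite risk of `AICc`. For `m > 4` this follows from `E‖w‖⁻⁴ < ∞`.
Inadmissibility for the remaining `m` is settled by a dichotomy on whether that risk is finite
anywhere (`inadmissible_AICc`). -/

namespace LinReg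

open scoped RealInnerProductSpace

/-! ### Isotropic Gaussian measures: densities and characteristic functions -/

section Density

variable {V : Type*} [NormedAddCommGroup V] [InnerProductSpace ℝ V] [FiniteDimensional ℝ V]
  [MeasurableSpace V] [BorelSpace V]

/-- The Lebesgue density of the Gaussian measure with mean `m` and covariance `s • id`. -/
noncomputable def gaussDensity (m : V) (s : ℝ) (x : V) : ℝ :=
  (2 * Real.pi * s) ^ (-(Module.finrank ℝ V : ℝ) / 2) * Real.exp (-‖x - m‖ ^ 2 / (2 * s))

omit [FiniteDimensional ℝ V] [MeasurableSpace V] [BorelSpace V] in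
lemma gaussDensity_pos (m : V) {s : ℝ} (hs : 0 < s) (x : V) : 0 < gaussDensity m s x := by
  unfold gaussDensity
  have := Real.pi_pos
  positivity

omit [FiniteDimensional ℝ V] [MeasurableSpace V] [BorelSpace V] in
lemma continuous_gaussDensity (m : V) (s : ℝ) : Continuous (gaussDensity m s) := by
  unfold gaussDensity
  fun_prop

lemma integrable_gaussDensity (m : V) {s : ℝ} (hs : 0 < s) :
    Integrable (gaussDensity m s) volume := by
  have h := GaussianFourier.integrable_cexp_neg_mul_sq_norm_add (V := V) (b := ((2 * s)⁻¹ : ℝ))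
    (by rw [Complex.ofReal_re]; positivity) 0 0
  have h2 := (h.norm.comp_sub_right m).const_mul
    ((2 * Real.pi * s) ^ (-(Module.finrank ℝ V : ℝ) / 2))
  refine h2.congr (Filter.Eventually.of_forall fun x => ?_)
  simp only [gaussDensity, Complex.norm_exp]
  congr 2
  simp [← Complex.ofReal_pow, ← Complex.ofReal_mul]
  norm_cast
  field_simp

/-- The Gaussian measure with density `gaussDensity m s`. -/
noncomputable def gaussMeasure (m : V) (s : ℝ) : Measure V :=
  volume.withDensity fun x => ENNReal.ofReal (gaussDensity m s x)

lemma isFiniteMeasure_gaussMeasure (m : V) {s : ℝ} (hs : 0 < s) :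
    IsFiniteMeasure (gaussMeasure m s) :=
  isFiniteMeasure_withDensity_ofReal (integrable_gaussDensity m hs).2

lemma integral_gaussMeasure {F : Type*} [NormedAddCommGroup F] [NormedSpace ℝ F]
    (m : V) {s : ℝ} (hs : 0 < s) (f : V → F) :
    ∫ x, f x ∂(gaussMeasure m s) = ∫ x, gaussDensity m s x • f x := by
  rw [gaussMeasure, integral_withDensity_eq_integral_toReal_smul
    (continuous_gaussDensity m s).measurable.ennreal_ofReal (by simp)]
  simp [ENNReal.toReal_ofReal (gaussDensity_pos m hs _).le]

lemma integrable_gaussMeasure_iff {F : Type*} [NormedAddCommGroup F] [NormedSpace ℝ F]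
    (m : V) {s : ℝ} (hs : 0 < s) (f : V → F) :
    Integrable f (gaussMeasure m s) ↔ Integrable (fun x => gaussDensity m s x • f x) := by
  rw [gaussMeasure, integrable_withDensity_iff_integrable_smul'
    (continuous_gaussDensity m s).measurable.ennreal_ofReal (by simp)]
  simp [ENNReal.toReal_ofReal (gaussDensity_pos m hs _).le]

/-- Translating by `m` reduces this to the Fourier transform of a centered Gaussian. It is the
bridge by which the density description, the image of `stdGaussian` under an affine map, and
`multivariateGaussian` are identified. -/
lemma charFun_gaussMeasure (m : V) {s : ℝ} (hs : 0 < s) (t : V) :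
    charFun (gaussMeasure m s) t
      = Complex.exp ((⟪m, t⟫ : ℝ) * Complex.I - (s * ‖t‖ ^ 2 / 2 : ℝ)) := by
  have hre : 0 < (((2 * s)⁻¹ : ℝ) : ℂ).re := by rw [Complex.ofReal_re]; positivity
  have hint := GaussianFourier.integral_cexp_neg_mul_sq_norm_add (V := V) hre Complex.I t
  rw [charFun_apply, integral_gaussMeasure m hs, ← integral_add_right_eq_self _ m]
  have hpi := Real.pi_pos
  have hC : (((2 * Real.pi * s) ^ (-(Module.finrank ℝ V : ℝ) / 2) : ℝ) : ℂ)
      * (Real.pi / ((2 * s)⁻¹ : ℝ)) ^ (Module.finrank ℝ V / 2 : ℂ) = 1 := by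
    have h1 : (Real.pi / ((2 * s)⁻¹ : ℝ) : ℂ) = ((2 * Real.pi * s : ℝ) : ℂ) := by
      rw [← Complex.ofReal_div]; congr 1; field_simp
    have h2 : (Module.finrank ℝ V / 2 : ℂ) = ((Module.finrank ℝ V / 2 : ℝ) : ℂ) := by
      push_cast; rfl
    rw [h1, h2, ← Complex.ofReal_cpow (by positivity), ← Complex.ofReal_mul,
      ← Real.rpow_add (by positivity), neg_div, neg_add_cancel, Real.rpow_zero, Complex.ofReal_one]
  have key : ∀ x : V, gaussDensity m s (x + m) • Complex.exp ((⟪x + m, t⟫ : ℝ) * Complex.I)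
      = ((((2 * Real.pi * s) ^ (-(Module.finrank ℝ V : ℝ) / 2) : ℝ) : ℂ)
        * Complex.exp ((⟪m, t⟫ : ℝ) * Complex.I))
        * Complex.exp (-((2 * s)⁻¹ : ℝ) * ‖x‖ ^ 2 + Complex.I * (⟪t, x⟫ : ℝ)) := by
    intro x
    simp only [gaussDensity, add_sub_cancel_right, Complex.real_smul, Complex.ofReal_mul,
      Complex.ofReal_exp, mul_assoc]
    rw [← Complex.exp_add, ← Complex.exp_add]
    congr 2
    rw [inner_add_left, real_inner_comm t x]
    push_cast
    ring
  simp_rw [key]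
  rw [integral_const_mul, hint, mul_mul_mul_comm, hC, one_mul, ← Complex.exp_add]
  congr 1
  have : (s : ℂ) ≠ 0 := by exact_mod_cast hs.ne'
  push_cast
  rw [Complex.I_sq]
  field_simp
  ring

lemma stdGaussian_eq_gaussMeasure : stdGaussian V = gaussMeasure (0 : V) 1 := by
  have := isFiniteMeasure_gaussMeasure (0 : V) one_pos
  apply Measure.ext_of_charFun
  ext t
  rw [charFun_stdGaussian, charFun_gaussMeasure _ one_pos]
  simp [neg_div]

lemma stdGaussian_map_add_smul (m : V) {s : ℝ} (hs : 0 < s) :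
    (stdGaussian V).map (fun x => m + √s • x) = gaussMeasure m s := by
  have := isFiniteMeasure_gaussMeasure m hs
  apply Measure.ext_of_charFun
  ext t
  have : (fun x : V => m + √s • x) = (m + ·) ∘ (√s • ·) := rfl
  rw [this, ← Measure.map_map (by fun_prop) (by fun_prop), charFun_map_const_add,
    charFun_map_smul, charFun_stdGaussian, charFun_gaussMeasure _ hs, ← Complex.exp_add]
  congr 1
  rw [← Complex.ofReal_pow, norm_smul, mul_pow, Real.norm_eq_abs, sq_abs, Real.sq_sqrt hs.le]
  push_cast
  ring

lemma stdGaussian_singleton_zero [Nontrivial V] (x : V) : stdGaussian V {x} = 0 := by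
  rw [stdGaussian_eq_gaussMeasure]
  exact withDensity_absolutelyContinuous _ _ (measure_singleton x)

end Density

lemma law_eq_map {n p : ℕ} (X : Matrix (Fin n) (Fin p) ℝ) (β : Fin p → ℝ) {s : ℝ} (hs : 0 < s) :
    law X β s = (stdGaussian (EuclideanSpace ℝ (Fin n))).map (fun x => fit X β + √s • x) := by
  rw [stdGaussian_map_add_smul _ hs, law]
  have := isFiniteMeasure_gaussMeasure (fit X β) hs
  apply Measure.ext_of_charFun
  ext t
  rw [charFun_multivariateGaussian (Matrix.PosSemidef.one.smul hs.le), charFun_gaussMeasure _ hs]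
  congr 1
  rw [real_inner_comm, Matrix.smul_mulVec, Matrix.one_mulVec, dotProduct_smul,
    EuclideanSpace.real_norm_sq_eq, dotProduct]
  simp [pow_two]

lemma density_eq_gaussDensity {n p : ℕ} (X : Matrix (Fin n) (Fin p) ℝ) (β : Fin p → ℝ) (s : ℝ) :
    density X β s = gaussDensity (fit X β) s := by
  ext y
  simp [density, gaussDensity]

/-! ### Stein's identity and polynomial moments -/

section Stein

variable {V : Type*} [NormedAddCommGroup V] [InnerProductSpace ℝ V] [FiniteDimensional ℝ V]
  [MeasurableSpace V] [BorelSpace V]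

lemma integrable_one_add_norm_pow (N : ℕ) :
    Integrable (fun x : V => (1 + ‖x‖) ^ N) (stdGaussian V) := by
  have h : MemLp (fun x : V => 1 + ‖x‖) N (stdGaussian V) :=
by
    have h1 : MemLp (fun x : V => ‖x‖) N (stdGaussian V) :=
      (IsGaussian.memLp_id (stdGaussian V) (N : ℝ≥0∞) (ENNReal.natCast_ne_top N)).norm
    exact (memLp_const (1 : ℝ)).add h1
  refine h.integrable_norm_pow'.congr (Filter.Eventually.of_forall fun x => ?_)
  simp only [Real.norm_eq_abs]
  rw [abs_of_nonneg (by positivity)]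

lemma integrable_of_norm_le_pow {f : V → ℝ} (hf : AEStronglyMeasurable f (stdGaussian V))
    (C : ℝ) (N : ℕ) (h : ∀ x, |f x| ≤ C * (1 + ‖x‖) ^ N) : Integrable f (stdGaussian V) :=
  ((integrable_one_add_norm_pow N).const_mul C).mono' hf (Filter.Eventually.of_forall h)

lemma integrable_norm_pow_stdGaussian (N : ℕ) :
    Integrable (fun x : V => ‖x‖ ^ N) (stdGaussian V) := by
  refine integrable_of_norm_le_pow (by fun_prop) 1 N fun x => ?_
  rw [abs_of_nonneg (by positivity), one_mul]
  gcongr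
  linarith

/-- Stein's identity in a fixed direction. -/
lemma integral_mul_inner_eq_integral_fderiv {f : V → ℝ} (hf : Differentiable ℝ f) (v : V)
    (h0 : Integrable f (stdGaussian V))
    (h1 : Integrable (fun x => f x * ⟪x, v⟫) (stdGaussian V))
    (h2 : Integrable (fun x => fderiv ℝ f x v) (stdGaussian V)) :
    ∫ x, f x * ⟪x, v⟫ ∂(stdGaussian V) = ∫ x, fderiv ℝ f x v ∂(stdGaussian V) := by
  set φ : V → ℝ := gaussDensity (0 : V) 1
  -- The standard density satisfies `∇φ = -φ x`, so Stein's identity is integration by parts against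
  -- `φ`.
  have hφ : ∀ x, HasFDerivAt φ (-φ x • innerSL ℝ x) x := by
    intro x
    have h1 : HasFDerivAt (fun x : V => -‖x - 0‖ ^ 2 / (2 * 1)) (-innerSL ℝ x) x := by
      have := ((hasStrictFDerivAt_norm_sq x).hasFDerivAt.neg).mul_const (2⁻¹ : ℝ)
      refine (this.congr_fderiv ?_).congr_of_eventuallyEq (Filter.Eventually.of_forall ?_)
      · ext y; simp
      · intro y; simp; ring
    refine (h1.exp.const_mul ((2 * Real.pi * 1) ^ (-(Module.finrank ℝ V : ℝ) / 2))).congr_fderiv ?_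
    ext y
    simp [φ, gaussDensity]
    ring
  have hφ' : ∀ x, fderiv ℝ φ x v = -(φ x * ⟪x, v⟫) := by
    intro x
    rw [(hφ x).fderiv]
    simp
  rw [stdGaussian_eq_gaussMeasure] at h0 h1 h2 ⊢
  rw [integrable_gaussMeasure_iff _ one_pos] at h0 h1 h2
  rw [integral_gaussMeasure _ one_pos, integral_gaussMeasure _ one_pos]
  have := integral_mul_fderiv_eq_neg_fderiv_mul_of_integrable (𝕜 := ℝ) (f := f) (g := φ) (v := v)
    (μ := volume) (h2.congr (Filter.Eventually.of_forall fun x => by simp [φ, mul_comm]))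
    (h1.neg.congr (Filter.Eventually.of_forall fun x => by simp [hφ', φ]; ring))
    (h0.congr (Filter.Eventually.of_forall fun x => by simp [φ, mul_comm]))
    (fun x _ => hf x) (fun x _ => (hφ x).differentiableAt)
  simp_rw [hφ', mul_neg, integral_neg, neg_inj] at this
  convert! this using 3 with x x
  · simp [φ]; ring
  · simp [φ]; ring

/-- Stein's identity for the vector field `x ↦ g x • (x + a)`. -/
lemma integral_mul_inner_add_eq {g : V → ℝ} {G : V → V}
    (hg : ∀ x, HasFDerivAt g (innerSL ℝ (G x)) x) (hG : Continuous G) (a : V) (C : ℝ) (N : ℕ)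
    (hgC : ∀ x, |g x| ≤ C * (1 + ‖x‖) ^ N) (hGC : ∀ x, ‖G x‖ ≤ C * (1 + ‖x‖) ^ N) :
    ∫ x, g x * ⟪x + a, x⟫ ∂(stdGaussian V)
      = Module.finrank ℝ V * ∫ x, g x ∂(stdGaussian V)
        + ∫ x, ⟪G x, x + a⟫ ∂(stdGaussian V) := by
  have hgcont : Continuous g := continuous_iff_continuousAt.2 fun x => (hg x).continuousAt
  have hC : 0 ≤ C := by simpa using (abs_nonneg _).trans (hgC 0)
  set b := stdOrthonormalBasis ℝ V
  have hbn : ∀ i, ‖b i‖ = 1 := fun i => b.orthonormal.1 i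
  have hA : (0 : ℝ) ≤ 1 + ‖a‖ := by positivity
  have hin : ∀ i x, |⟪x + a, b i⟫| ≤ (1 + ‖a‖) * (1 + ‖x‖) := by
    intro i x
    calc |⟪x + a, b i⟫| ≤ ‖x + a‖ * ‖b i‖ := abs_real_inner_le_norm _ _
      _ ≤ ‖x‖ + ‖a‖ := by rw [hbn, mul_one]; exact norm_add_le _ _
      _ ≤ _ := by nlinarith [norm_nonneg x, norm_nonneg a]
  have hin0 : ∀ i x, |⟪x, b i⟫| ≤ 1 + ‖x‖ := by
    intro i x
    calc |⟪x, b i⟫| ≤ ‖x‖ * ‖b i‖ := abs_real_inner_le_norm _ _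
      _ ≤ _ := by rw [hbn]; linarith
  have hGi : ∀ i x, |⟪G x, b i⟫| ≤ C * (1 + ‖x‖) ^ N := by
    intro i x
    calc |⟪G x, b i⟫| ≤ ‖G x‖ * ‖b i‖ := abs_real_inner_le_norm _ _
      _ ≤ _ := by rw [hbn, mul_one]; exact hGC x
  have hgint : Integrable g (stdGaussian V) :=
    integrable_of_norm_le_pow hgcont.aestronglyMeasurable C N hgC
  have hd : ∀ i x, HasFDerivAt (fun x => g x * ⟪x + a, b i⟫)
      (g x • innerSL ℝ (b i) + ⟪x + a, b i⟫ • innerSL ℝ (G x)) x := by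
    intro i x
    refine (hg x).mul ?_
    have : HasFDerivAt (fun x : V => innerSL ℝ (b i) (x + a)) (innerSL ℝ (b i)) x :=
      (innerSL ℝ (b i)).hasFDerivAt.comp x ((hasFDerivAt_id x).add_const a)
    refine this.congr_of_eventuallyEq (Filter.Eventually.of_forall fun y => ?_)
    simp [real_inner_comm]
  have hGint : ∀ i, Integrable (fun x => ⟪x + a, b i⟫ * ⟪G x, b i⟫) (stdGaussian V) := by
    intro i
    refine integrable_of_norm_le_pow (by fun_prop) ((1 + ‖a‖) * C) (N + 1) fun x => ?_
    rw [abs_mul]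
    calc _ ≤ ((1 + ‖a‖) * (1 + ‖x‖)) * (C * (1 + ‖x‖) ^ N) := by
          gcongr
          · exact hin i x
          · exact hGi i x
      _ = _ := by ring
  have hfd : ∀ i x, fderiv ℝ (fun x => g x * ⟪x + a, b i⟫) x (b i)
      = g x + ⟪x + a, b i⟫ * ⟪G x, b i⟫ := by
    intro i x
    rw [(hd i x).fderiv]
    simp [hbn]
  have hint1 : ∀ i, Integrable (fun x => g x * ⟪x + a, b i⟫) (stdGaussian V) := by
    intro i
    refine integrable_of_norm_le_pow (by fun_prop) (C * (1 + ‖a‖)) (N + 1) fun x => ?_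
    rw [abs_mul]
    calc _ ≤ (C * (1 + ‖x‖) ^ N) * ((1 + ‖a‖) * (1 + ‖x‖)) := by
          gcongr
          · exact hgC x
          · exact hin i x
      _ = _ := by ring
  have hint2 : ∀ i, Integrable (fun x => g x * ⟪x + a, b i⟫ * ⟪x, b i⟫) (stdGaussian V) := by
    intro i
    refine integrable_of_norm_le_pow (by fun_prop) (C * (1 + ‖a‖)) (N + 2) fun x => ?_
    rw [abs_mul, abs_mul]
    calc _ ≤ (C * (1 + ‖x‖) ^ N) * ((1 + ‖a‖) * (1 + ‖x‖)) * (1 + ‖x‖) := by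
          gcongr
          · exact hgC x
          · exact hin i x
          · exact hin0 i x
      _ = _ := by ring
  -- Directional Stein identity for the `i`-th coordinate of the field; summing over the orthonormal
  -- basis produces the divergence `k g + ⟪G, x + a⟫`, where `k` is the dimension.
  have hi : ∀ i, ∫ x, g x * ⟪x + a, b i⟫ * ⟪x, b i⟫ ∂(stdGaussian V)
      = ∫ x, g x ∂(stdGaussian V) + ∫ x, ⟪x + a, b i⟫ * ⟪G x, b i⟫ ∂(stdGaussian V) := by
    intro i
    rw [integral_mul_inner_eq_integral_fderiv (fun x => (hd i x).differentiableAt) (b i)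
      (hint1 i) (hint2 i), ← integral_add hgint (hGint i)]
    · simp_rw [hfd]
    · simp_rw [hfd]
      exact hgint.add (hGint i)
  calc ∫ x, g x * ⟪x + a, x⟫ ∂(stdGaussian V)
      = ∫ x, ∑ i, g x * ⟪x + a, b i⟫ * ⟪x, b i⟫ ∂(stdGaussian V) := by
        congr with x
        simp_rw [mul_assoc]
        rw [← Finset.mul_sum, ← b.sum_inner_mul_inner (x + a) x]
        simp_rw [real_inner_comm x]
    _ = ∑ i, (∫ x, g x ∂(stdGaussian V)
          + ∫ x, ⟪x + a, b i⟫ * ⟪G x, b i⟫ ∂(stdGaussian V)) := by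
        rw [integral_finsetSum _ fun i _ => hint2 i]
        simp_rw [hi]
    _ = _ := by
        rw [Finset.sum_add_distrib, ← integral_finsetSum _ fun i _ => hGint i]
        congr 1
        · simp
        · congr with x
          rw [real_inner_comm, ← b.sum_inner_mul_inner]
          simp_rw [real_inner_comm (G x)]

lemma integral_norm_sq_stdGaussian :
    ∫ x, ‖x‖ ^ 2 ∂(stdGaussian V) = Module.finrank ℝ V := by
  have := integral_mul_inner_add_eq (V := V) (g := fun _ => 1) (G := fun _ => 0)
    (fun x => by simpa using hasFDerivAt_const (1 : ℝ) x) continuous_const 0 1 0 (by simp) (by simp)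
  simpa using this

/-- Stein's identity with `g = ‖x‖²` and no shift: `E‖x‖⁴ = k E‖x‖² + 2 E‖x‖²`. -/
lemma integral_norm_pow_four_stdGaussian :
    ∫ x, ‖x‖ ^ 4 ∂(stdGaussian V) = Module.finrank ℝ V * (Module.finrank ℝ V + 2) := by
  have := integral_mul_inner_add_eq (V := V) (g := fun x => ‖x‖ ^ 2) (G := fun x => (2 : ℝ) • x)
    (fun x => (hasStrictFDerivAt_norm_sq x).hasFDerivAt.congr_fderiv
      (by rw [map_smul, two_smul, two_smul])) (by fun_prop) 0 2 2
    (fun x => by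
      rw [abs_of_nonneg (by positivity)]
      nlinarith [norm_nonneg x])
    (fun x => by
      rw [norm_smul, Real.norm_eq_abs, abs_of_pos two_pos]
      nlinarith [norm_nonneg x])
  simp only [add_zero, real_inner_self_eq_norm_sq, real_inner_smul_left, ← pow_add,
    integral_const_mul, integral_norm_sq_stdGaussian] at this
  rw [this]
  ring

end Stein

/-! ### Inverse moments of a noncentral Gaussian vector -/

section InverseMoments

open Filter Topology

variable {V : Type*} [NormedAddCommGroup V] [InnerProductSpace ℝ V] [FiniteDimensional ℝ V]
  [MeasurableSpace V] [BorelSpace V]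

/-- With `u = (‖x+ν‖² + ε)⁻¹`, Stein's identity for the field `u x` leaves the term `-2 E[u² ⟪x+ν,
x⟫]`, and a second application, to `u² (x+ν)`, evaluates it. The regularization makes `u` smooth and
bounded, so that no integrability has to be known beforehand. -/
lemma regularized_stein_le (ν : V) {ε : ℝ} (hε : 0 < ε) :
    ∫ x, (‖x + ν‖ ^ 2 + ε)⁻¹ * ‖x‖ ^ 2 ∂(stdGaussian V)
      ≤ Module.finrank ℝ V * ∫ x, (‖x + ν‖ ^ 2 + ε)⁻¹ ∂(stdGaussian V)
        - 2 * (Module.finrank ℝ V - 4) * ∫ x, (‖x + ν‖ ^ 2 + ε)⁻¹ ^ 2 ∂(stdGaussian V) := by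
  set u : V → ℝ := fun x => (‖x + ν‖ ^ 2 + ε)⁻¹ with hu
  have hD : ∀ x : V, ‖x + ν‖ ^ 2 + ε ≠ 0 := fun x => by positivity
  have hu0 : ∀ x, 0 < u x := fun x => by simp only [hu]; positivity
  have huε : ∀ x, u x ≤ ε⁻¹ := fun x => by
    simp only [hu]
    gcongr
    nlinarith [sq_nonneg ‖x + ν‖]
  have hucont : Continuous u := by
    simp only [hu]
    exact Continuous.inv₀ (by fun_prop) hD
  have hlin : ∀ x, ‖x + ν‖ ≤ (1 + ‖ν‖) * (1 + ‖x‖) := fun x => by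
    nlinarith [norm_add_le x ν, norm_nonneg x, norm_nonneg ν]
  have hnsq : ∀ x, HasFDerivAt (fun x : V => ‖x + ν‖ ^ 2 + ε)
      ((2 : ℝ) • innerSL ℝ (x + ν)) x := fun x => by
    have h := (hasStrictFDerivAt_norm_sq (x + ν)).hasFDerivAt.comp x
      ((hasFDerivAt_id x).add_const ν)
    refine (h.add_const ε).congr_fderiv ?_
    ext y
    simp [two_mul]
  have hdu : ∀ x, HasFDerivAt u (innerSL ℝ (-(2 * u x ^ 2) • (x + ν))) x := fun x => by
    refine ((hasDerivAt_inv (hD x)).comp_hasFDerivAt x (hnsq x)).congr_fderiv ?_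
    ext y
    simp [hu]
    ring
  have hdu2 : ∀ x, HasFDerivAt (fun x => u x ^ 2) (innerSL ℝ (-(4 * u x ^ 3) • (x + ν))) x :=
    fun x => by
    refine ((hdu x).pow 2).congr_fderiv ?_
    ext y
    simp
    ring
  have hint : ∀ j : ℕ, Integrable (fun x => u x ^ j) (stdGaussian V) := fun j => by
    refine integrable_of_norm_le_pow (by fun_prop) (ε⁻¹ ^ j) 0 fun x => ?_
    rw [abs_of_nonneg (pow_nonneg (hu0 x).le _), pow_zero, mul_one]
    exact pow_le_pow_left₀ (hu0 x).le (huε x) j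
  have hε' : 0 < ε⁻¹ := inv_pos.2 hε
  have e1 := integral_mul_inner_add_eq hdu (by fun_prop) 0
    (ε⁻¹ + 2 * ε⁻¹ ^ 2 * (1 + ‖ν‖)) 1
    (fun x => by
      rw [abs_of_pos (hu0 x), pow_one]
      have : 0 ≤ 2 * ε⁻¹ ^ 2 * (1 + ‖ν‖) := by positivity
      nlinarith [huε x, norm_nonneg x, mul_nonneg this (norm_nonneg x),
        mul_nonneg hε'.le (norm_nonneg x)])
    (fun x => by
      rw [norm_smul, Real.norm_eq_abs, abs_neg, abs_of_nonneg (by positivity), pow_one]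
      calc 2 * u x ^ 2 * ‖x + ν‖ ≤ 2 * ε⁻¹ ^ 2 * ((1 + ‖ν‖) * (1 + ‖x‖)) := by
            gcongr
            · exact huε x
            · exact hlin x
        _ ≤ _ := by nlinarith [mul_nonneg hε'.le (norm_nonneg x)])
  have e2 := integral_mul_inner_add_eq hdu2 (by fun_prop) ν
    (ε⁻¹ ^ 2 + 4 * ε⁻¹ ^ 3 * (1 + ‖ν‖)) 1
    (fun x => by
      rw [abs_of_nonneg (sq_nonneg _), pow_one]
      have h1 : u x ^ 2 ≤ ε⁻¹ ^ 2 := pow_le_pow_left₀ (hu0 x).le (huε x) 2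
      have : 0 ≤ 4 * ε⁻¹ ^ 3 * (1 + ‖ν‖) := by positivity
      nlinarith [norm_nonneg x, mul_nonneg this (norm_nonneg x),
        mul_nonneg (sq_nonneg ε⁻¹) (norm_nonneg x)])
    (fun x => by
      have := hu0 x
      rw [norm_smul, Real.norm_eq_abs, abs_neg, abs_of_nonneg (by positivity), pow_one]
      calc 4 * u x ^ 3 * ‖x + ν‖ ≤ 4 * ε⁻¹ ^ 3 * ((1 + ‖ν‖) * (1 + ‖x‖)) := by
            gcongr
            · exact huε x
            · exact hlin x
        _ ≤ _ := by nlinarith [mul_nonneg (sq_nonneg ε⁻¹) (norm_nonneg x), sq_nonneg ε⁻¹])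
  simp only [add_zero, real_inner_self_eq_norm_sq, real_inner_smul_left, neg_mul] at e1 e2
  rw [integral_neg] at e1 e2
  have h3 : ∫ x, 4 * u x ^ 3 * ‖x + ν‖ ^ 2 ∂(stdGaussian V)
      ≤ 4 * ∫ x, u x ^ 2 ∂(stdGaussian V) := by
    rw [← integral_const_mul]
    refine integral_mono_of_nonneg (Eventually.of_forall fun x => ?_) ((hint 2).const_mul 4)
      (Eventually.of_forall fun x => ?_)
    · have := hu0 x
      positivity
    -- The only loss in the estimate: `u³ ‖x+ν‖² = u² - ε u³ ≤ u²`.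
    · have h5 : u x * (‖x + ν‖ ^ 2 + ε) = 1 := inv_mul_cancel₀ (hD x)
      have h6 : u x ^ 3 * ‖x + ν‖ ^ 2 = u x ^ 2 - ε * u x ^ 3 := by
        linear_combination u x ^ 2 * h5
      have := mul_pos hε (pow_pos (hu0 x) 3)
      dsimp only
      linarith
  have h4 : ∫ x, 2 * u x ^ 2 * ⟪x + ν, x⟫ ∂(stdGaussian V)
      = 2 * ∫ x, u x ^ 2 * ⟪x + ν, x⟫ ∂(stdGaussian V) := by
    rw [← integral_const_mul]
    simp_rw [mul_assoc]
  rw [e1, h4, e2]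
  linarith

lemma integral_sq_le_integral_pow_two {f : V → ℝ} (hf : Integrable f (stdGaussian V))
    (hf2 : Integrable (fun x => f x ^ 2) (stdGaussian V)) :
    (∫ x, f x ∂(stdGaussian V)) ^ 2 ≤ ∫ x, f x ^ 2 ∂(stdGaussian V) := by
  set a := ∫ x, f x ∂(stdGaussian V) with ha
  have hsub : Integrable (fun x => f x ^ 2 - 2 * a * f x) (stdGaussian V) :=
    hf2.sub (hf.const_mul _)
  have h : 0 ≤ ∫ x, (f x ^ 2 - 2 * a * f x + a ^ 2) ∂(stdGaussian V) :=
    integral_nonneg fun x => by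
      have : f x ^ 2 - 2 * a * f x + a ^ 2 = (f x - a) ^ 2 := by ring
      simp only [this]
      positivity
  rw [integral_add hsub (integrable_const _),
    integral_sub hf2 (hf.const_mul _), integral_const_mul, ← ha] at h
  simp at h
  linarith

lemma tendsto_regularized_inv {D : ℝ} (hD : D ≠ 0) :
    Tendsto (fun j : ℕ => (D + 1 / ((j : ℝ) + 1))⁻¹) atTop (𝓝 D⁻¹) := by
  have := (tendsto_one_div_add_atTop_nhds_zero_nat (𝕜 := ℝ)).const_add D
  rw [add_zero] at this
  exact this.inv₀ hD

lemma integrable_regularized_pow (ν : V) {ε : ℝ} (hε : 0 < ε) (j : ℕ) :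
    Integrable (fun x => (‖x + ν‖ ^ 2 + ε)⁻¹ ^ j) (stdGaussian V) := by
  have hD : ∀ x : V, ‖x + ν‖ ^ 2 + ε ≠ 0 := fun x => by positivity
  refine integrable_of_norm_le_pow (Continuous.aestronglyMeasurable
    ((Continuous.inv₀ (by fun_prop) hD).pow j)) (ε⁻¹ ^ j) 0 fun x => ?_
  rw [abs_of_nonneg (by positivity), pow_zero, mul_one]
  gcongr
  nlinarith [sq_nonneg ‖x + ν‖]

lemma ae_norm_add_sq_ne_zero [Nontrivial V] (ν : V) :
    ∀ᵐ x ∂(stdGaussian V), ‖x + ν‖ ^ 2 ≠ 0 := by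
  have : {x : V | ¬ ‖x + ν‖ ^ 2 ≠ 0} = {-ν} := by
    ext x
    simp [add_eq_zero_iff_eq_neg]
  rw [ae_iff, this]
  exact stdGaussian_singleton_zero _

omit [FiniteDimensional ℝ V] [MeasurableSpace V] [BorelSpace V] in
lemma nontrivial_of_five_le_finrank (hk : 5 ≤ Module.finrank ℝ V) : Nontrivial V :=
  Module.nontrivial_of_finrank_pos (R := ℝ) (by omega)

/-- The inverse fourth moment of a noncentral Gaussian vector is finite in dimension at least
five. -/
lemma integrable_inv_norm_sq_sq (hk : 5 ≤ Module.finrank ℝ V) (ν : V) :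
    Integrable (fun x => (‖x + ν‖ ^ 2)⁻¹ ^ 2) (stdGaussian V) := by
  have := nontrivial_of_five_le_finrank hk
  have hk' : (5 : ℝ) ≤ Module.finrank ℝ V := by exact_mod_cast hk
  set k : ℝ := (Module.finrank ℝ V : ℝ)
  set M : ℝ := k / (2 * (k - 4)) with hM
  -- The Stein inequality bootstraps its own integrability: its left side is nonnegative, so `b ≤ M
  -- a`. With `a² ≤ b` this forces `a ≤ M` and hence `b ≤ M²`, uniformly in `ε`.
  have hbound : ∀ ε : ℝ, 0 < ε → ∫ x, (‖x + ν‖ ^ 2 + ε)⁻¹ ^ 2 ∂(stdGaussian V) ≤ M ^ 2 := by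
    intro ε hε
    have h1 := regularized_stein_le ν hε
    have hi1 := integrable_regularized_pow ν hε 1
    simp only [pow_one] at hi1
    have h2 := integral_sq_le_integral_pow_two hi1 (integrable_regularized_pow ν hε 2)
    have h3 : 0 ≤ ∫ x, (‖x + ν‖ ^ 2 + ε)⁻¹ * ‖x‖ ^ 2 ∂(stdGaussian V) :=
      integral_nonneg fun x => by positivity
    have h4 : 0 ≤ ∫ x, (‖x + ν‖ ^ 2 + ε)⁻¹ ∂(stdGaussian V) :=
      integral_nonneg fun x => by positivity
    set a := ∫ x, (‖x + ν‖ ^ 2 + ε)⁻¹ ∂(stdGaussian V)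
    set b := ∫ x, (‖x + ν‖ ^ 2 + ε)⁻¹ ^ 2 ∂(stdGaussian V)
    have hMpos : 0 < M := by rw [hM]; apply div_pos <;> linarith
    have hb : b ≤ M * a := by
      rw [hM, div_mul_eq_mul_div, le_div_iff₀ (by linarith)]
      linarith
    have ha : a ≤ M := by
      by_contra! hlt
      nlinarith
    nlinarith
  have hae : ∀ᵐ x ∂(stdGaussian V), Tendsto
      (fun j : ℕ => ENNReal.ofReal ((‖x + ν‖ ^ 2 + 1 / ((j : ℝ) + 1))⁻¹ ^ 2)) atTop
      (𝓝 (ENNReal.ofReal ((‖x + ν‖ ^ 2)⁻¹ ^ 2))) := by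
    filter_upwards [ae_norm_add_sq_ne_zero ν] with x hx
    exact ENNReal.tendsto_ofReal ((tendsto_regularized_inv hx).pow 2)
  have hmeas : Measurable fun x : V => (‖x + ν‖ ^ 2)⁻¹ ^ 2 := by fun_prop
  refine ⟨hmeas.aestronglyMeasurable, ?_⟩
  rw [hasFiniteIntegral_iff_ofReal (Eventually.of_forall fun x => by positivity)]
  -- Fatou's lemma along `ε = 1/(j+1)` carries the uniform bound to the limit.
  calc ∫⁻ x, ENNReal.ofReal ((‖x + ν‖ ^ 2)⁻¹ ^ 2) ∂(stdGaussian V)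
      = ∫⁻ x, liminf (fun j : ℕ => ENNReal.ofReal ((‖x + ν‖ ^ 2 + 1 / ((j : ℝ) + 1))⁻¹ ^ 2)) atTop
          ∂(stdGaussian V) := by
        refine lintegral_congr_ae ?_
        filter_upwards [hae] with x hx
        exact hx.liminf_eq.symm
    _ ≤ liminf (fun j : ℕ => ∫⁻ x, ENNReal.ofReal ((‖x + ν‖ ^ 2 + 1 / ((j : ℝ) + 1))⁻¹ ^ 2)
          ∂(stdGaussian V)) atTop :=
        lintegral_liminf_le fun j => by fun_prop
    _ ≤ ENNReal.ofReal (M ^ 2) := by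
        refine liminf_le_of_frequently_le' (Frequently.of_forall fun j => ?_)
        have hj : (0 : ℝ) < 1 / ((j : ℝ) + 1) := by positivity
        rw [← ofReal_integral_eq_lintegral_ofReal (integrable_regularized_pow ν hj 2)
          (Eventually.of_forall fun x => by positivity)]
        exact ENNReal.ofReal_le_ofReal (hbound _ hj)
    _ < ∞ := ENNReal.ofReal_lt_top

lemma integrable_inv_norm_sq (hk : 5 ≤ Module.finrank ℝ V) (ν : V) :
    Integrable (fun x => (‖x + ν‖ ^ 2)⁻¹) (stdGaussian V) := by
  have hmeas : Measurable fun x : V => (‖x + ν‖ ^ 2)⁻¹ := by fun_prop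
  refine ((integrable_const (1 : ℝ)).add (integrable_inv_norm_sq_sq hk ν)).mono'
    hmeas.aestronglyMeasurable (Eventually.of_forall fun x => ?_)
  rw [Real.norm_eq_abs, abs_of_nonneg (by positivity)]
  simp only [Pi.add_apply]
  nlinarith [sq_nonneg ((‖x + ν‖ ^ 2)⁻¹ - 1)]

lemma integrable_inv_norm_sq_mul_norm_sq (hk : 5 ≤ Module.finrank ℝ V) (ν : V) :
    Integrable (fun x => (‖x + ν‖ ^ 2)⁻¹ * ‖x‖ ^ 2) (stdGaussian V) := by
  have hmeas : Measurable fun x : V => (‖x + ν‖ ^ 2)⁻¹ * ‖x‖ ^ 2 := by fun_prop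
  refine ((integrable_const (2 : ℝ)).add
    ((integrable_inv_norm_sq hk ν).const_mul (2 * ‖ν‖ ^ 2))).mono'
    hmeas.aestronglyMeasurable (Eventually.of_forall fun x => ?_)
  rw [Real.norm_eq_abs, abs_of_nonneg (by positivity)]
  simp only [Pi.add_apply]
  have h1 : ‖x‖ ^ 2 ≤ 2 * ‖x + ν‖ ^ 2 + 2 * ‖ν‖ ^ 2 := by
    have h2 : ‖x‖ ≤ ‖x + ν‖ + ‖ν‖ := by simpa using norm_sub_le (x + ν) ν
    nlinarith [norm_nonneg x, sq_nonneg (‖x + ν‖ - ‖ν‖)]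
  have h3 : (‖x + ν‖ ^ 2)⁻¹ * ‖x + ν‖ ^ 2 ≤ 1 := inv_mul_le_one
  calc (‖x + ν‖ ^ 2)⁻¹ * ‖x‖ ^ 2 ≤ (‖x + ν‖ ^ 2)⁻¹ * (2 * ‖x + ν‖ ^ 2 + 2 * ‖ν‖ ^ 2) := by gcongr
    _ ≤ _ := by linarith

/-- Limit `ε → 0` of `regularized_stein_le`; each regularized integrand is dominated by its
unregularized version, whose integrability is already established. -/
lemma integral_inv_norm_sq_mul_norm_sq_le (hk : 5 ≤ Module.finrank ℝ V) (ν : V) :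
    ∫ x, (‖x + ν‖ ^ 2)⁻¹ * ‖x‖ ^ 2 ∂(stdGaussian V)
      ≤ Module.finrank ℝ V * ∫ x, (‖x + ν‖ ^ 2)⁻¹ ∂(stdGaussian V)
        - 2 * (Module.finrank ℝ V - 4) * ∫ x, (‖x + ν‖ ^ 2)⁻¹ ^ 2 ∂(stdGaussian V) := by
  have := nontrivial_of_five_le_finrank hk
  have hle : ∀ (j : ℕ) (x : V), ‖x + ν‖ ^ 2 ≠ 0 →
      (‖x + ν‖ ^ 2 + 1 / ((j : ℝ) + 1))⁻¹ ≤ (‖x + ν‖ ^ 2)⁻¹ := by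
    intro j x hx
    have : 0 < ‖x + ν‖ ^ 2 := lt_of_le_of_ne (by positivity) hx.symm
    have hj : (0 : ℝ) < 1 / ((j : ℝ) + 1) := by positivity
    gcongr
    linarith
  have t0 : Tendsto (fun j : ℕ => ∫ x, (‖x + ν‖ ^ 2 + 1 / ((j : ℝ) + 1))⁻¹ * ‖x‖ ^ 2
      ∂(stdGaussian V)) atTop (𝓝 (∫ x, (‖x + ν‖ ^ 2)⁻¹ * ‖x‖ ^ 2 ∂(stdGaussian V))) := by
    refine tendsto_integral_of_dominated_convergence _
      (fun j => Measurable.aestronglyMeasurable (by fun_prop))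
      (integrable_inv_norm_sq_mul_norm_sq hk ν) (fun j => ?_) ?_
    · filter_upwards [ae_norm_add_sq_ne_zero ν] with x hx
      rw [Real.norm_eq_abs, abs_of_nonneg (by positivity)]
      gcongr ?_ * _
      exact hle j x hx
    · filter_upwards [ae_norm_add_sq_ne_zero ν] with x hx
      exact (tendsto_regularized_inv hx).mul_const _
  have t1 : Tendsto (fun j : ℕ => ∫ x, (‖x + ν‖ ^ 2 + 1 / ((j : ℝ) + 1))⁻¹
      ∂(stdGaussian V)) atTop (𝓝 (∫ x, (‖x + ν‖ ^ 2)⁻¹ ∂(stdGaussian V))) := by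
    refine tendsto_integral_of_dominated_convergence _
      (fun j => Measurable.aestronglyMeasurable (by fun_prop))
      (integrable_inv_norm_sq hk ν) (fun j => ?_) ?_
    · filter_upwards [ae_norm_add_sq_ne_zero ν] with x hx
      rw [Real.norm_eq_abs, abs_of_nonneg (by positivity)]
      exact hle j x hx
    · filter_upwards [ae_norm_add_sq_ne_zero ν] with x hx
      exact tendsto_regularized_inv hx
  have t2 : Tendsto (fun j : ℕ => ∫ x, (‖x + ν‖ ^ 2 + 1 / ((j : ℝ) + 1))⁻¹ ^ 2
      ∂(stdGaussian V)) atTop (𝓝 (∫ x, (‖x + ν‖ ^ 2)⁻¹ ^ 2 ∂(stdGaussian V))) := by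
    refine tendsto_integral_of_dominated_convergence _
      (fun j => Measurable.aestronglyMeasurable (by fun_prop))
      (integrable_inv_norm_sq_sq hk ν) (fun j => ?_) ?_
    · filter_upwards [ae_norm_add_sq_ne_zero ν] with x hx
      rw [Real.norm_eq_abs, abs_of_nonneg (by positivity)]
      gcongr ?_ ^ 2
      exact hle j x hx
    · filter_upwards [ae_norm_add_sq_ne_zero ν] with x hx
      exact (tendsto_regularized_inv hx).pow 2
  exact le_of_tendsto_of_tendsto' t0 ((t1.const_mul _).sub (t2.const_mul _)) fun j =>
    regularized_stein_le ν (by positivity)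

/-- Source of the strict inequality in the final comparison. -/
lemma integral_inv_norm_sq_pos (hk : 5 ≤ Module.finrank ℝ V) (ν : V) :
    0 < ∫ x, (‖x + ν‖ ^ 2)⁻¹ ∂(stdGaussian V) := by
  have := nontrivial_of_five_le_finrank hk
  rw [integral_pos_iff_support_of_nonneg (fun x => by positivity) (integrable_inv_norm_sq hk ν)]
  have h : Function.support (fun x : V => (‖x + ν‖ ^ 2)⁻¹) = {-ν}ᶜ := by
    ext x
    simp [add_eq_zero_iff_eq_neg]
  rw [h, prob_compl_eq_one_sub (measurableSet_singleton _), stdGaussian_singleton_zero]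
  simp

end InverseMoments

/-! ### Independent components and the expected error difference -/

section Product

variable {V W : Type*} [NormedAddCommGroup V] [InnerProductSpace ℝ V] [FiniteDimensional ℝ V]
  [MeasurableSpace V] [BorelSpace V] [NormedAddCommGroup W] [InnerProductSpace ℝ W]
  [FiniteDimensional ℝ W] [MeasurableSpace W] [BorelSpace W]

/-- The standard Gaussian measure is the sum of independent standard Gaussians on a subspace and
its orthogonal complement. -/
lemma stdGaussian_eq_map_prod_orthogonal (K : Submodule ℝ V) :
    stdGaussian V = ((stdGaussian K).prod (stdGaussian Kᗮ)).map
      (fun z => (z.1 : V) + (z.2 : V)) := by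
  have hm : Measurable fun z : K × Kᗮ => (z.1 : V) + (z.2 : V) :=
    Continuous.measurable (by fun_prop)
  have : IsProbabilityMeasure (((stdGaussian K).prod (stdGaussian Kᗮ)).map
      (fun z => (z.1 : V) + (z.2 : V))) := Measure.isProbabilityMeasure_map hm.aemeasurable
  apply Measure.ext_of_charFun
  ext t
  have h1 : ∀ v : K, ⟪(v : V), t⟫ = ⟪v, K.orthogonalProjectionOnto t⟫ := fun v => by
    rw [Submodule.inner_orthogonalProjectionOnto_eq_of_mem_left]
  have h2 : ∀ v : Kᗮ, ⟪(v : V), t⟫ = ⟪v, Kᗮ.orthogonalProjectionOnto t⟫ := fun v => by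
    rw [Submodule.inner_orthogonalProjectionOnto_eq_of_mem_left]
  rw [charFun_stdGaussian, charFun_apply, integral_map hm.aemeasurable (by fun_prop)]
  simp_rw [inner_add_left, Complex.ofReal_add, add_mul, Complex.exp_add, h1, h2]
  rw [integral_prod_mul (fun v : K => Complex.exp ((⟪v, K.orthogonalProjectionOnto t⟫ : ℝ) * Complex.I))
    (fun v : Kᗮ => Complex.exp ((⟪v, Kᗮ.orthogonalProjectionOnto t⟫ : ℝ) * Complex.I)),
    ← charFun_apply, ← charFun_apply, charFun_stdGaussian, charFun_stdGaussian, ← Complex.exp_add]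
  congr 1
  have := K.norm_sq_eq_add_norm_sq_projection t
  rw [← Complex.ofReal_pow, this]
  push_cast
  ring

/-- The difference of squared errors of the two loss estimators, as a function of the independent
standardized components of the observation. -/
noncomputable def errorDiff (n c : ℝ) (ν : V) (z : V × W) : ℝ :=
  (c / n) ^ 2 * ((‖z.1 + ν‖ ^ 2)⁻¹ ^ 2 * ‖z.2‖ ^ 4)
    - 2 * c * (n + Module.finrank ℝ V) / (Module.finrank ℝ W - 2)
      * ((‖z.1 + ν‖ ^ 2)⁻¹ * ‖z.2‖ ^ 2)
    -- The factors `1` stand for a constant function of `z.2`, so that every term is a product to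
    -- which the Fubini lemmas apply.
    + 2 * c * (n * ((‖z.1 + ν‖ ^ 2)⁻¹ * 1) + (‖z.1 + ν‖ ^ 2)⁻¹ * ‖z.1‖ ^ 2 * 1)

section

variable (hV : 5 ≤ Module.finrank ℝ V) (n c : ℝ) (ν : V)
include hV

lemma integrable_inv_sq_mul_norm_pow_four :
    Integrable (fun z : V × W => (‖z.1 + ν‖ ^ 2)⁻¹ ^ 2 * ‖z.2‖ ^ 4)
      ((stdGaussian V).prod (stdGaussian W)) :=
  (integrable_inv_norm_sq_sq hV ν).mul_prod (integrable_norm_pow_stdGaussian 4)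

lemma integrable_inv_mul_norm_sq :
    Integrable (fun z : V × W => (‖z.1 + ν‖ ^ 2)⁻¹ * ‖z.2‖ ^ 2)
      ((stdGaussian V).prod (stdGaussian W)) :=
  (integrable_inv_norm_sq hV ν).mul_prod (integrable_norm_pow_stdGaussian 2)

lemma integrable_inv_mul_one :
    Integrable (fun z : V × W => (‖z.1 + ν‖ ^ 2)⁻¹ * 1)
      ((stdGaussian V).prod (stdGaussian W)) :=
  (integrable_inv_norm_sq hV ν).mul_prod (integrable_const 1)

lemma integrable_inv_mul_norm_sq_mul_one :
    Integrable (fun z : V × W => (‖z.1 + ν‖ ^ 2)⁻¹ * ‖z.1‖ ^ 2 * 1)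
      ((stdGaussian V).prod (stdGaussian W)) :=
  (integrable_inv_norm_sq_mul_norm_sq hV ν).mul_prod (integrable_const 1)

lemma integrable_errorDiff :
    Integrable (errorDiff n c ν : V × W → ℝ) ((stdGaussian V).prod (stdGaussian W)) :=
  (((integrable_inv_sq_mul_norm_pow_four hV ν).const_mul _).sub
    ((integrable_inv_mul_norm_sq hV ν).const_mul _)).add
    ((((integrable_inv_mul_one hV ν).const_mul _).add
      (integrable_inv_mul_norm_sq_mul_one hV ν)).const_mul _)

lemma integral_errorDiff :
    ∫ z : V × W, errorDiff n c ν z ∂((stdGaussian V).prod (stdGaussian W))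
      = (c / n) ^ 2 * ((∫ x, (‖x + ν‖ ^ 2)⁻¹ ^ 2 ∂(stdGaussian V))
          * (Module.finrank ℝ W * (Module.finrank ℝ W + 2)))
        - 2 * c * (n + Module.finrank ℝ V) / (Module.finrank ℝ W - 2)
          * ((∫ x, (‖x + ν‖ ^ 2)⁻¹ ∂(stdGaussian V)) * Module.finrank ℝ W)
        + 2 * c * (n * (∫ x, (‖x + ν‖ ^ 2)⁻¹ ∂(stdGaussian V))
          + ∫ x, (‖x + ν‖ ^ 2)⁻¹ * ‖x‖ ^ 2 ∂(stdGaussian V)) := by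
  have i1 := (integrable_inv_sq_mul_norm_pow_four (W := W) hV ν).const_mul ((c / n) ^ 2)
  have i2 := (integrable_inv_mul_norm_sq (W := W) hV ν).const_mul
    (2 * c * (n + Module.finrank ℝ V) / (Module.finrank ℝ W - 2))
  have i3 := (integrable_inv_mul_one (W := W) hV ν).const_mul n
  have i4 := integrable_inv_mul_norm_sq_mul_one (W := W) hV ν
  have i12 : Integrable (fun z : V × W => (c / n) ^ 2 * ((‖z.1 + ν‖ ^ 2)⁻¹ ^ 2 * ‖z.2‖ ^ 4)
    - 2 * c * (n + Module.finrank ℝ V) / (Module.finrank ℝ W - 2)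
      * ((‖z.1 + ν‖ ^ 2)⁻¹ * ‖z.2‖ ^ 2)) ((stdGaussian V).prod (stdGaussian W)) := i1.sub i2
  have i34 : Integrable (fun z : V × W => 2 * c * (n * ((‖z.1 + ν‖ ^ 2)⁻¹ * 1)
    + (‖z.1 + ν‖ ^ 2)⁻¹ * ‖z.1‖ ^ 2 * 1)) ((stdGaussian V).prod (stdGaussian W)) :=
    (i3.add i4).const_mul _
  unfold errorDiff
  rw [integral_add i12 i34, integral_sub i1 i2, integral_const_mul, integral_const_mul,
    integral_const_mul, integral_add i3 i4, integral_const_mul,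
    integral_prod_mul (fun x : V => (‖x + ν‖ ^ 2)⁻¹ ^ 2) (fun w : W => ‖w‖ ^ 4),
    integral_prod_mul (fun x : V => (‖x + ν‖ ^ 2)⁻¹) (fun w : W => ‖w‖ ^ 2),
    integral_prod_mul (fun x : V => (‖x + ν‖ ^ 2)⁻¹) (fun _ : W => (1 : ℝ)),
    integral_prod_mul (fun x : V => (‖x + ν‖ ^ 2)⁻¹ * ‖x‖ ^ 2) (fun _ : W => (1 : ℝ)),
    integral_norm_pow_four_stdGaussian, integral_norm_sq_stdGaussian]
  simp

lemma integral_errorDiff_neg (hW : 2 < Module.finrank ℝ W) (hn : 0 < n) (hc : 0 < c)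
    (hcn : c * (Module.finrank ℝ W * (Module.finrank ℝ W + 2))
      ≤ 4 * n ^ 2 * (Module.finrank ℝ V - 4)) :
    ∫ z : V × W, errorDiff n c ν z ∂((stdGaussian V).prod (stdGaussian W)) < 0 := by
  rw [integral_errorDiff hV]
  have he := integral_inv_norm_sq_mul_norm_sq_le hV ν
  have ha := integral_inv_norm_sq_pos hV ν
  have hb : 0 ≤ ∫ x, (‖x + ν‖ ^ 2)⁻¹ ^ 2 ∂(stdGaussian V) :=
    integral_nonneg fun x => by positivity
  set a := ∫ x, (‖x + ν‖ ^ 2)⁻¹ ∂(stdGaussian V)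
  set b := ∫ x, (‖x + ν‖ ^ 2)⁻¹ ^ 2 ∂(stdGaussian V)
  set e := ∫ x, (‖x + ν‖ ^ 2)⁻¹ * ‖x‖ ^ 2 ∂(stdGaussian V)
  set k : ℝ := (Module.finrank ℝ V : ℝ) with hk
  set m : ℝ := (Module.finrank ℝ W : ℝ) with hm
  have hm2 : 0 < m - 2 := by
    have : (2 : ℝ) < Module.finrank ℝ W := by exact_mod_cast hW
    linarith
  have hk0 : 0 ≤ k := Nat.cast_nonneg _
  -- The upper bound on `c` makes the quadratic term at most the Stein gain.
  have h1 : (c / n) ^ 2 * (b * (m * (m + 2))) ≤ c * b * (4 * (k - 4)) := by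
    have : (c / n) ^ 2 * (b * (m * (m + 2))) = c * b / n ^ 2 * (c * (m * (m + 2))) := by
      field_simp
    rw [this]
    calc _ ≤ c * b / n ^ 2 * (4 * n ^ 2 * (k - 4)) := by gcongr
      _ = _ := by field_simp
  -- Writing `m/(m-2) = 1 + 2/(m-2)`, the part from `1` cancels the remaining terms in `a`; the part
  -- from `2/(m-2)` is the strictly positive surplus.
  have h2 : 2 * c * (n + k) / (m - 2) * (a * m)
      = 2 * c * (n + k) * a + 4 * c * (n + k) * a / (m - 2) := by
    field_simp
    ring
  have h3 : 0 < 4 * c * (n + k) * a / (m - 2) := by positivity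
  have h4 : 2 * c * (n * a + e) ≤ 2 * c * (n * a + (k * a - 2 * (k - 4) * b)) := by gcongr
  rw [h2]
  linarith

end

/-- Squared error of `AICc` in standardized form. Expanding the square brings in `‖z.2‖⁻⁴`, whence
the dimension condition on `W`, which becomes `n - p > 4`. -/
lemma integrable_sq_sub_mul_inv_norm_sq (hW : 5 ≤ Module.finrank ℝ W) (C n : ℝ) :
    Integrable (fun z : V × W => (C - n * ((n + ‖z.1‖ ^ 2) * (‖z.2‖ ^ 2)⁻¹)) ^ 2)
      ((stdGaussian V).prod (stdGaussian W)) := by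
  have j2 := integrable_inv_norm_sq_sq hW (0 : W)
  have j1 := integrable_inv_norm_sq hW (0 : W)
  simp only [add_zero] at j1 j2
  have k1 : Integrable (fun x : V => n + ‖x‖ ^ 2) (stdGaussian V) :=
    (integrable_const n).add (integrable_norm_pow_stdGaussian 2)
  have k2 : Integrable (fun x : V => (n + ‖x‖ ^ 2) ^ 2) (stdGaussian V) := by
    refine (((integrable_const (n ^ 2)).add
      ((integrable_norm_pow_stdGaussian 2).const_mul (2 * n))).add
      (integrable_norm_pow_stdGaussian 4)).congr (Filter.Eventually.of_forall fun x => ?_)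
    simp only [Pi.add_apply]
    ring
  refine (((integrable_const (C ^ 2)).sub ((k1.mul_prod j1).const_mul (2 * C * n))).add
    ((k2.mul_prod j2).const_mul (n ^ 2))).congr (Filter.Eventually.of_forall fun z => ?_)
  simp only [Pi.add_apply, Pi.sub_apply]
  ring

end Product

/-! ### Closed form of the Kullback–Leibler discrepancy -/

section Discrepancy

variable {n p : ℕ} (X : Matrix (Fin n) (Fin p) ℝ)

lemma log_density (b : Fin p → ℝ) {t : ℝ} (ht : 0 < t) (z : EuclideanSpace ℝ (Fin n)) :
    Real.log (density X b t z)
      = -(n : ℝ) / 2 * Real.log (2 * Real.pi * t) - ‖z - fit X b‖ ^ 2 / (2 * t) := by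
  have := Real.pi_pos
  rw [density, Real.log_mul (by positivity) (by positivity), Real.log_rpow (by positivity),
    Real.log_exp]
  ring

/-- Substituting `z = Xβ + √s x` and expanding the square, the cross term is linear in `x` and
integrates to zero, while `E‖x‖² = n`. -/
lemma discrepancy_eq (β : Fin p → ℝ) {s : ℝ} (hs : 0 < s) (b : Fin p → ℝ) {t : ℝ} (ht : 0 < t) :
    discrepancy X β s b t
      = n * Real.log (2 * Real.pi * t) + (n * s + ‖fit X b - fit X β‖ ^ 2) / t := by
  set γ := stdGaussian (EuclideanSpace ℝ (Fin n))
  set δ := fit X β - fit X b with hδ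
  have h1 : ∫ z : EuclideanSpace ℝ (Fin n), density X β s z * Real.log (density X b t z)
      = ∫ x, (-(n : ℝ) / 2 * Real.log (2 * Real.pi * t) - ‖δ‖ ^ 2 / (2 * t)
        - s / (2 * t) * ‖x‖ ^ 2 - √s / t * innerSL ℝ δ x) ∂γ := by
    rw [density_eq_gaussDensity]
    have := integral_gaussMeasure (fit X β) hs (fun z => Real.log (density X b t z))
    simp only [smul_eq_mul] at this
    simp_rw [log_density X b ht] at this ⊢
    rw [← this, ← stdGaussian_map_add_smul _ hs, integral_map (by fun_prop) (by fun_prop)]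
    congr with x
    have hx : fit X β + √s • x - fit X b = δ + √s • x := by rw [hδ]; abel
    rw [hx, norm_add_sq_real, norm_smul, Real.norm_eq_abs, mul_pow, sq_abs, Real.sq_sqrt hs.le,
      real_inner_smul_right, innerSL_apply_apply]
    field_simp
    ring
  have i1 : Integrable (fun x : EuclideanSpace ℝ (Fin n) => s / (2 * t) * ‖x‖ ^ 2) γ :=
    (integrable_norm_pow_stdGaussian 2).const_mul _
  have i2 : Integrable (fun x : EuclideanSpace ℝ (Fin n) => √s / t * innerSL ℝ δ x) γ :=
    (IsGaussian.integrable_dual γ _).const_mul _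
  have i0 : Integrable (fun _ : EuclideanSpace ℝ (Fin n) =>
    -(n : ℝ) / 2 * Real.log (2 * Real.pi * t) - ‖δ‖ ^ 2 / (2 * t)) γ := integrable_const _
  have i01 : Integrable (fun x : EuclideanSpace ℝ (Fin n) =>
    -(n : ℝ) / 2 * Real.log (2 * Real.pi * t) - ‖δ‖ ^ 2 / (2 * t) - s / (2 * t) * ‖x‖ ^ 2) γ :=
    i0.sub i1
  rw [discrepancy, h1, integral_sub i01 i2, integral_sub i0 i1, integral_const_mul,
    integral_const_mul, integral_norm_sq_stdGaussian, integral_strongDual_stdGaussian,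
    integral_const, norm_sub_rev (fit X b)]
  simp
  field_simp
  ring

end Discrepancy

/-! ### Least squares in orthogonal coordinates -/

section LeastSquares

variable {n p : ℕ} (X : Matrix (Fin n) (Fin p) ℝ)

/-- The linear map `β ↦ X β` into Euclidean space. -/
noncomputable def fitLin : (Fin p → ℝ) →ₗ[ℝ] EuclideanSpace ℝ (Fin n) :=
  (WithLp.linearEquiv 2 ℝ (Fin n → ℝ)).symm.toLinearMap ∘ₗ X.mulVecLin

lemma fitLin_apply (b : Fin p → ℝ) : fitLin X b = fit X b := rfl

/-- The column space of the design matrix. -/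
noncomputable def colSpace : Submodule ℝ (EuclideanSpace ℝ (Fin n)) := LinearMap.range (fitLin X)

lemma fit_mem_colSpace (b : Fin p → ℝ) : fit X b ∈ colSpace X := ⟨b, rfl⟩

variable {X} in
lemma mulVec_injective_of_rank (hX : X.rank = p) : Function.Injective X.mulVec := by
  have h := X.mulVecLin.finrank_range_add_finrank_ker
  have h' : Module.finrank ℝ (LinearMap.range X.mulVecLin) = p := hX
  rw [h', Module.finrank_fin_fun] at h
  have h2 : LinearMap.ker X.mulVecLin = ⊥ := by
    rw [← Submodule.finrank_eq_zero]
    omega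
  exact LinearMap.ker_eq_bot.1 h2

variable {X} in
lemma isUnit_transpose_mul_self (hX : X.rank = p) : IsUnit (Xᵀ * X) := by
  rw [← Matrix.mulVec_injective_iff_isUnit]
  exact mulVec_injective_of_rank (by rw [Matrix.rank_transpose_mul_self, hX])

variable {X} in
lemma finrank_colSpace (hX : X.rank = p) : Module.finrank ℝ (colSpace X) = p := by
  rw [colSpace, LinearMap.finrank_range_of_inj, Module.finrank_fin_fun]
  exact (WithLp.linearEquiv 2 ℝ (Fin n → ℝ)).symm.injective.comp (mulVec_injective_of_rank hX)

variable {X} in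
lemma finrank_colSpace_orthogonal (hX : X.rank = p) :
    p + Module.finrank ℝ (colSpace X)ᗮ = n := by
  have h := (colSpace X).finrank_add_finrank_orthogonal
  rwa [finrank_colSpace hX, finrank_euclideanSpace_fin] at h

variable {X} in
lemma betaHat_fit (hX : X.rank = p) (b : Fin p → ℝ) : betaHat X (fit X b) = b := by
  simp only [betaHat, fit]
  rw [Matrix.mulVec_mulVec, Matrix.mulVec_mulVec, Matrix.mul_assoc,
    Matrix.nonsing_inv_mul _ ((Matrix.isUnit_iff_isUnit_det _).1 (isUnit_transpose_mul_self hX)),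
    Matrix.one_mulVec]

lemma betaHat_of_mem_orthogonal {w : EuclideanSpace ℝ (Fin n)} (hw : w ∈ (colSpace X)ᗮ) :
    betaHat X w = 0 := by
  have h : Xᵀ *ᵥ w.ofLp = 0 := by
    ext j
    have := (Submodule.mem_orthogonal _ _).1 hw _ (fit_mem_colSpace X (Pi.single j 1))
    simp only [fit, Matrix.mulVec_single_one] at this
    rw [real_inner_comm, PiLp.inner_apply] at this
    simpa [Matrix.mulVec, dotProduct, Matrix.col, mul_comm] using this
  simp [betaHat, h]

lemma betaHat_add (y z : EuclideanSpace ℝ (Fin n)) :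
    betaHat X (y + z) = betaHat X y + betaHat X z := by
  simp [betaHat, Matrix.mulVec_add]

variable {X} in
lemma fit_betaHat_add (hX : X.rank = p) {v w : EuclideanSpace ℝ (Fin n)} (hv : v ∈ colSpace X)
    (hw : w ∈ (colSpace X)ᗮ) : fit X (betaHat X (v + w)) = v := by
  obtain ⟨b, rfl⟩ := hv
  rw [betaHat_add, fitLin_apply, betaHat_fit hX, betaHat_of_mem_orthogonal X hw, add_zero]

lemma continuous_fit : Continuous (fit X) := by
  unfold fit
  fun_prop

lemma continuous_betaHat : Continuous (betaHat X) := by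
  unfold betaHat
  fun_prop

lemma continuous_sigmaSqHat : Continuous (sigmaSqHat X) := by
  have := (continuous_fit X).comp (continuous_betaHat X)
  simp only [Function.comp_def] at this
  unfold sigmaSqHat
  fun_prop

lemma measurable_AICc : Measurable (AICc X) := by
  have := (continuous_sigmaSqHat X).measurable
  unfold AICc
  fun_prop

lemma measurable_MAICc (c : ℝ) : Measurable (MAICc X c) := by
  have h1 := (continuous_sigmaSqHat X).measurable
  have h2 := measurable_AICc X
  have h3 := ((continuous_fit X).comp (continuous_betaHat X)).measurable
  simp only [Function.comp_def] at h3
  unfold MAICc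
  fun_prop

/-- The closed form of the Kullback-Leibler loss, valid when `σ̂² > 0`. -/
noncomputable def closedLoss (β : Fin p → ℝ) (s : ℝ) (y : EuclideanSpace ℝ (Fin n)) : ℝ :=
  n * Real.log (2 * Real.pi * sigmaSqHat X y)
    + (n * s + ‖fit X (betaHat X y) - fit X β‖ ^ 2) / sigmaSqHat X y

lemma measurable_closedLoss (β : Fin p → ℝ) (s : ℝ) : Measurable (closedLoss X β s) := by
  have h1 := (continuous_sigmaSqHat X).measurable
  have h3 := ((continuous_fit X).comp (continuous_betaHat X)).measurable
  simp only [Function.comp_def] at h3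
  unfold closedLoss
  fun_prop

lemma loss_eq_closedLoss (β : Fin p → ℝ) {s : ℝ} (hs : 0 < s) {y : EuclideanSpace ℝ (Fin n)}
    (hy : 0 < sigmaSqHat X y) : loss X β s y = closedLoss X β s y :=
  discrepancy_eq X β hs _ hy

/-- The observation as a function of the standardized components of the noise in the column
space and in its orthogonal complement. -/
noncomputable def observation (β : Fin p → ℝ) (s : ℝ) (z : colSpace X × (colSpace X)ᗮ) :
    EuclideanSpace ℝ (Fin n) :=
  fit X β + √s • ((z.1 : EuclideanSpace ℝ (Fin n)) + (z.2 : EuclideanSpace ℝ (Fin n)))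

/-- The joint law of the standardized components of the noise. -/
noncomputable def noiseLaw : Measure (colSpace X × (colSpace X)ᗮ) :=
  (stdGaussian (colSpace X)).prod (stdGaussian (colSpace X)ᗮ)

lemma measurable_observation (β : Fin p → ℝ) (s : ℝ) : Measurable (observation X β s) := by
  refine Continuous.measurable ?_
  unfold observation
  fun_prop

lemma law_eq_map_observation (β : Fin p → ℝ) {s : ℝ} (hs : 0 < s) :
    law X β s = (noiseLaw X).map (observation X β s) := by
  rw [law_eq_map X β hs, stdGaussian_eq_map_prod_orthogonal (colSpace X),
    Measure.map_map (by fun_prop) (Continuous.measurable (by fun_prop))]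
  rfl

/-- The standardized mean of the observation. -/
noncomputable def standardizedMean (β : Fin p → ℝ) (s : ℝ) : colSpace X :=
  (√s)⁻¹ • ⟨fit X β, fit_mem_colSpace X β⟩

variable {X} (hX : X.rank = p)
include hX

lemma fit_betaHat_observation (β : Fin p → ℝ) (s : ℝ) (z : colSpace X × (colSpace X)ᗮ) :
    fit X (betaHat X (observation X β s z))
      = fit X β + √s • (z.1 : EuclideanSpace ℝ (Fin n)) := by
  rw [observation, smul_add, ← add_assoc]
  exact fit_betaHat_add hX
    ((colSpace X).add_mem (fit_mem_colSpace X β) ((colSpace X).smul_mem _ z.1.2))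
    ((colSpace X)ᗮ.smul_mem _ z.2.2)

lemma sigmaSqHat_observation (β : Fin p → ℝ) {s : ℝ} (hs : 0 < s)
    (z : colSpace X × (colSpace X)ᗮ) :
    sigmaSqHat X (observation X β s z) = s * ‖z.2‖ ^ 2 / n := by
  rw [sigmaSqHat, fit_betaHat_observation hX, observation]
  have : fit X β + √s • ((z.1 : EuclideanSpace ℝ (Fin n)) + (z.2 : EuclideanSpace ℝ (Fin n)))
      - (fit X β + √s • (z.1 : EuclideanSpace ℝ (Fin n)))
      = √s • (z.2 : EuclideanSpace ℝ (Fin n)) := by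
    rw [smul_add]; abel
  rw [this, norm_smul, mul_pow, Real.norm_eq_abs, sq_abs, Real.sq_sqrt hs.le, Submodule.coe_norm]

lemma norm_sq_fit_betaHat_observation (β : Fin p → ℝ) {s : ℝ} (hs : 0 < s)
    (z : colSpace X × (colSpace X)ᗮ) :
    ‖fit X (betaHat X (observation X β s z))‖ ^ 2 = s * ‖z.1 + standardizedMean X β s‖ ^ 2 := by
  have hsq : √s ≠ 0 := (Real.sqrt_pos.2 hs).ne'
  have : fit X β + √s • (z.1 : EuclideanSpace ℝ (Fin n))
      = √s • ((z.1 + standardizedMean X β s : colSpace X) : EuclideanSpace ℝ (Fin n)) := by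
    simp [standardizedMean, smul_smul, hsq, add_comm]
  rw [fit_betaHat_observation hX, this, norm_smul, mul_pow, Real.norm_eq_abs, sq_abs,
    Real.sq_sqrt hs.le, Submodule.coe_norm]

variable (hnp : p + 2 < n)
include hnp

lemma ae_noise_ne_zero : ∀ᵐ z ∂(noiseLaw X), ‖z.2‖ ^ 2 ≠ 0 := by
  have := finrank_colSpace_orthogonal hX
  have : Nontrivial (colSpace X)ᗮ := Module.nontrivial_of_finrank_pos (R := ℝ) (by omega)
  have h := ae_norm_add_sq_ne_zero (0 : (colSpace X)ᗮ)
  simp only [add_zero] at h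
  exact Measure.quasiMeasurePreserving_snd.ae h

lemma ae_sigmaSqHat_pos (β : Fin p → ℝ) {s : ℝ} (hs : 0 < s) :
    ∀ᵐ y ∂(law X β s), 0 < sigmaSqHat X y := by
  rw [law_eq_map_observation X β hs, ae_map_iff (measurable_observation X β s).aemeasurable
    (measurableSet_lt measurable_const (continuous_sigmaSqHat X).measurable)]
  filter_upwards [ae_noise_ne_zero hX hnp] with z hz
  have hz' : 0 < ‖z.2‖ ^ 2 := lt_of_le_of_ne (by positivity) hz.symm
  have hn : (0 : ℝ) < n := by exact_mod_cast (by omega : 0 < n)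
  rw [sigmaSqHat_observation hX β hs]
  positivity

lemma ae_loss_eq (β : Fin p → ℝ) {s : ℝ} (hs : 0 < s) :
    ∀ᵐ y ∂(law X β s), loss X β s y = closedLoss X β s y := by
  filter_upwards [ae_sigmaSqHat_pos hX hnp β hs] with y hy
  exact loss_eq_closedLoss X β hs hy

/-- The logarithmic terms cancel and so do the factors `s`, leaving an expression free of the
parameters. -/
lemma AICc_sub_closedLoss_observation (β : Fin p → ℝ) {s : ℝ} (hs : 0 < s)
    {z : colSpace X × (colSpace X)ᗮ} (hz : ‖z.2‖ ^ 2 ≠ 0) :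
    AICc X (observation X β s z) - closedLoss X β s (observation X β s z)
      = (n : ℝ) * ((n : ℝ) + p) / ((n : ℝ) - p - 2)
        - n * ((n + ‖z.1‖ ^ 2) * (‖z.2‖ ^ 2)⁻¹) := by
  have hn : (0 : ℝ) < n := by exact_mod_cast (by omega : 0 < n)
  have hz' : 0 < ‖z.2‖ ^ 2 := lt_of_le_of_ne (by positivity) hz.symm
  have hσ : s * ‖z.2‖ ^ 2 / n ≠ 0 := by positivity
  have hd : fit X (betaHat X (observation X β s z)) - fit X β
      = √s • (z.1 : EuclideanSpace ℝ (Fin n)) := by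
    rw [fit_betaHat_observation hX, add_sub_cancel_left]
  rw [AICc, closedLoss, hd, sigmaSqHat_observation hX β hs, norm_smul, mul_pow, Real.norm_eq_abs,
    sq_abs, Real.sq_sqrt hs.le, ← Submodule.coe_norm z.1,
    Real.log_mul (x := 2 * Real.pi) (by positivity) hσ]
  generalize (n : ℝ) * ((n : ℝ) + p) / ((n : ℝ) - p - 2) = C
  field_simp
  ring

omit hnp in
lemma MAICc_observation (c : ℝ) (β : Fin p → ℝ) {s : ℝ} (hs : 0 < s)
    (z : colSpace X × (colSpace X)ᗮ) :
    MAICc X c (observation X β s z) = AICc X (observation X β s z)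
      - c / n * ((‖z.1 + standardizedMean X β s‖ ^ 2)⁻¹ * ‖z.2‖ ^ 2) := by
  rw [MAICc, sigmaSqHat_observation hX β hs, norm_sq_fit_betaHat_observation hX β hs, mul_inv]
  field_simp

/-- In the cross term the correction's `‖z.2‖²` cancels the `‖z.2‖⁻²` of the error, which is where
`hz` is essential. -/
lemma errorDiff_observation (c : ℝ) (β : Fin p → ℝ) {s : ℝ} (hs : 0 < s)
    {z : colSpace X × (colSpace X)ᗮ} (hz : ‖z.2‖ ^ 2 ≠ 0) :
    (MAICc X c (observation X β s z) - closedLoss X β s (observation X β s z)) ^ 2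
      - (AICc X (observation X β s z) - closedLoss X β s (observation X β s z)) ^ 2
      = errorDiff (n : ℝ) c (standardizedMean X β s) z := by
  have hn : (n : ℝ) ≠ 0 := by exact_mod_cast (by omega : n ≠ 0)
  have hm : ((Module.finrank ℝ (colSpace X)ᗮ : ℕ) : ℝ) = n - p := by
    have : (p : ℝ) + Module.finrank ℝ (colSpace X)ᗮ = n := by
      exact_mod_cast finrank_colSpace_orthogonal hX
    linarith
  have hA := AICc_sub_closedLoss_observation hX hnp β hs hz
  rw [MAICc_observation hX c β hs, sub_right_comm, hA, errorDiff, hm, finrank_colSpace hX]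
  generalize (‖z.1 + standardizedMean X β s‖ ^ 2)⁻¹ = Q
  have hm2 : (n : ℝ) - p - 2 ≠ 0 := by
    have : (p : ℝ) + 2 < n := by exact_mod_cast hnp
    linarith
  generalize ‖z.1‖ ^ 2 = A at *
  have h4 : ‖z.2‖ ^ 4 = (‖z.2‖ ^ 2) ^ 2 := by ring
  rw [h4]
  generalize ‖z.2‖ ^ 2 = B at *
  field_simp
  ring

lemma errorDiff_law (c : ℝ) (hp : 5 ≤ p) (hc : 0 < c) (hcb : c ≤ cBar n p) (β : Fin p → ℝ) {s : ℝ}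
    (hs : 0 < s) :
    Integrable (fun y => (MAICc X c y - loss X β s y) ^ 2 - (AICc X y - loss X β s y) ^ 2)
      (law X β s) ∧
    ∫ y, ((MAICc X c y - loss X β s y) ^ 2 - (AICc X y - loss X β s y) ^ 2) ∂(law X β s) < 0 := by
  -- `closedLoss` is visibly measurable and agrees almost surely with `loss`, so it replaces `loss`
  -- before the change of variables.
  have hae : (fun y => (MAICc X c y - closedLoss X β s y) ^ 2 - (AICc X y - closedLoss X β s y) ^ 2)
      =ᵐ[law X β s]
      fun y => (MAICc X c y - loss X β s y) ^ 2 - (AICc X y - loss X β s y) ^ 2 := by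
    filter_upwards [ae_loss_eq hX hnp β hs] with y hy
    rw [hy]
  have hmeas : Measurable fun y =>
      (MAICc X c y - closedLoss X β s y) ^ 2 - (AICc X y - closedLoss X β s y) ^ 2 := by
    have h1 := measurable_MAICc X c
    have h2 := measurable_AICc X
    have h3 := measurable_closedLoss X β s
    fun_prop
  have hobs := (measurable_observation X β s).aemeasurable (μ := noiseLaw X)
  have hae2 : errorDiff (n : ℝ) c (standardizedMean X β s) =ᵐ[noiseLaw X]
      fun z => (MAICc X c (observation X β s z) - closedLoss X β s (observation X β s z)) ^ 2
        - (AICc X (observation X β s z) - closedLoss X β s (observation X β s z)) ^ 2 := by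
    filter_upwards [ae_noise_ne_zero hX hnp] with z hz
    rw [errorDiff_observation hX hnp c β hs hz]
  have hV : 5 ≤ Module.finrank ℝ (colSpace X) := by rwa [finrank_colSpace hX]
  have hW := finrank_colSpace_orthogonal hX
  have hpn : (p : ℝ) + 2 < n := by exact_mod_cast hnp
  constructor
  · refine Integrable.congr ?_ hae
    rw [law_eq_map_observation X β hs, integrable_map_measure hmeas.aestronglyMeasurable hobs]
    exact (integrable_errorDiff hV _ _ _).congr hae2
  · rw [← integral_congr_ae hae, law_eq_map_observation X β hs,
      integral_map hobs hmeas.aestronglyMeasurable, ← integral_congr_ae hae2]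
    refine integral_errorDiff_neg hV _ _ _ (by omega) (by exact_mod_cast (by omega : 0 < n)) hc ?_
    have hm : ((Module.finrank ℝ (colSpace X)ᗮ : ℕ) : ℝ) = n - p := by
      have : (p : ℝ) + Module.finrank ℝ (colSpace X)ᗮ = n := by exact_mod_cast hW
      linarith
    rw [hm, finrank_colSpace hX]
    rwa [cBar, le_div_iff₀ (mul_pos (by linarith) (by linarith))] at hcb

lemma risk_AICc_ne_top (hn4 : p + 4 < n) (β : Fin p → ℝ) {s : ℝ} (hs : 0 < s) :
    risk X (AICc X) β s ≠ ∞ := by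
  have hmeas : Measurable fun y => ENNReal.ofReal ((AICc X y - closedLoss X β s y) ^ 2) := by
    have h2 := measurable_AICc X
    have h3 := measurable_closedLoss X β s
    fun_prop
  have hW := finrank_colSpace_orthogonal hX
  have h1 : risk X (AICc X) β s = ∫⁻ z, ENNReal.ofReal
      (((n : ℝ) * ((n : ℝ) + p) / ((n : ℝ) - p - 2)
        - n * ((n + ‖z.1‖ ^ 2) * (‖z.2‖ ^ 2)⁻¹)) ^ 2) ∂(noiseLaw X) := by
    rw [risk]
    calc _ = ∫⁻ y, ENNReal.ofReal ((AICc X y - closedLoss X β s y) ^ 2) ∂(law X β s) := by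
          refine lintegral_congr_ae ?_
          filter_upwards [ae_loss_eq hX hnp β hs] with y hy
          rw [hy]
      _ = _ := by
          rw [law_eq_map_observation X β hs, lintegral_map hmeas (measurable_observation X β s)]
          refine lintegral_congr_ae ?_
          filter_upwards [ae_noise_ne_zero hX hnp] with z hz
          rw [AICc_sub_closedLoss_observation hX hnp β hs hz]
  rw [h1]
  exact (integrable_sq_sub_mul_inv_norm_sq (V := colSpace X) (W := (colSpace X)ᗮ) (by omega)
    _ _).lintegral_lt_top.ne

end LeastSquares

/-! ### From the error difference to domination -/

section Domination

variable {n p : ℕ} {X : Matrix (Fin n) (Fin p) ℝ}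

lemma aemeasurable_sq_error (hX : X.rank = p) (hnp : p + 2 < n)
    {l : EuclideanSpace ℝ (Fin n) → ℝ} (hl : Measurable l) (β : Fin p → ℝ) {s : ℝ} (hs : 0 < s) :
    AEMeasurable (fun y => (l y - loss X β s y) ^ 2) (law X β s) := by
  have h3 := measurable_closedLoss X β s
  refine ⟨fun y => (l y - closedLoss X β s y) ^ 2, by fun_prop, ?_⟩
  filter_upwards [ae_loss_eq hX hnp β hs] with y hy
  rw [hy]

/-- Finite risk of `l₂` makes both squared errors integrable, so the integral of the difference
splits. -/
lemma risk_lt_of_integral_neg (hX : X.rank = p) (hnp : p + 2 < n)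
    {l₁ l₂ : EuclideanSpace ℝ (Fin n) → ℝ} (h₂ : Measurable l₂)
    (β : Fin p → ℝ) {s : ℝ} (hs : 0 < s)
    (hi : Integrable (fun y => (l₁ y - loss X β s y) ^ 2 - (l₂ y - loss X β s y) ^ 2) (law X β s))
    (hneg : ∫ y, ((l₁ y - loss X β s y) ^ 2 - (l₂ y - loss X β s y) ^ 2) ∂(law X β s) < 0)
    (hfin : risk X l₂ β s ≠ ∞) : risk X l₁ β s < risk X l₂ β s := by
  have i2 : Integrable (fun y => (l₂ y - loss X β s y) ^ 2) (law X β s) := by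
    refine ⟨(aemeasurable_sq_error hX hnp h₂ β hs).aestronglyMeasurable, ?_⟩
    rw [hasFiniteIntegral_iff_ofReal (Filter.Eventually.of_forall fun y => sq_nonneg _)]
    exact hfin.lt_top
  have i1 : Integrable (fun y => (l₁ y - loss X β s y) ^ 2) (law X β s) :=
    (hi.add i2).congr (Filter.Eventually.of_forall fun y => by simp)
  rw [integral_sub i1 i2, sub_neg] at hneg
  rw [risk, risk, ← ofReal_integral_eq_lintegral_ofReal i1
      (Filter.Eventually.of_forall fun y => sq_nonneg _),
    ← ofReal_integral_eq_lintegral_ofReal i2 (Filter.Eventually.of_forall fun y => sq_nonneg _)]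
  exact (ENNReal.ofReal_lt_ofReal_iff_of_nonneg (integral_nonneg fun y => sq_nonneg _)).2 hneg

/-- Where `AICc` has infinite risk the comparison is trivial; elsewhere it is strict. One parameter
of finite risk is thus enough. -/
lemma dominates_MAICc_of_risk_ne_top (hX : X.rank = p) (hnp : p + 2 < n) (hp : 5 ≤ p) {c : ℝ}
    (hc : 0 < c) (hcb : c ≤ cBar n p)
    (hfin : ∃ (β : Fin p → ℝ) (s : ℝ), 0 < s ∧ risk X (AICc X) β s ≠ ∞) :
    Dominates X (MAICc X c) (AICc X) := by
  have key : ∀ (β : Fin p → ℝ) (s : ℝ), 0 < s → risk X (AICc X) β s ≠ ∞ →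
      risk X (MAICc X c) β s < risk X (AICc X) β s := fun β s hs h =>
    have hd := errorDiff_law hX hnp c hp hc hcb β hs
    risk_lt_of_integral_neg hX hnp (measurable_AICc X) β hs hd.1 hd.2 h
  refine ⟨fun β s hs => ?_, ?_⟩
  · by_cases h : risk X (AICc X) β s = ∞
    · rw [h]
      exact le_top
    · exact (key β s hs h).le
  · obtain ⟨β, s, hs, h⟩ := hfin
    exact ⟨β, s, hs, key β s hs h⟩

/-- If the risk of `AICc` is finite somewhere, `MAICc` dominates. If it is infinite everywhere, any
estimator is at least as good, and the loss computed as if `(β, σ²) = (0, 1)` were true has risk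
zero at that parameter. -/
lemma inadmissible_AICc (hX : X.rank = p) (hnp : p + 2 < n) (hp : 5 ≤ p) (hcb : 0 < cBar n p) :
    Inadmissible X (AICc X) := by
  by_cases hfin : ∃ (β : Fin p → ℝ) (s : ℝ), 0 < s ∧ risk X (AICc X) β s ≠ ∞
  · exact ⟨MAICc X (cBar n p), measurable_MAICc X _,
      dominates_MAICc_of_risk_ne_top hX hnp hp hcb le_rfl hfin⟩
  · push Not at hfin
    refine ⟨closedLoss X 0 1, measurable_closedLoss X 0 1, fun β s hs => ?_, 0, 1, one_pos, ?_⟩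
    · rw [hfin β s hs]
      exact le_top
    · rw [hfin 0 1 one_pos]
      have : risk X (closedLoss X 0 1) 0 1 = 0 := by
        rw [risk, ← lintegral_zero (μ := law X 0 1)]
        refine lintegral_congr_ae ?_
        filter_upwards [ae_loss_eq hX hnp 0 one_pos] with y hy
        simp [hy]
      rw [this]
      exact ENNReal.zero_lt_top

lemma cBar_pos_iff (hnp : p + 2 < n) : 0 < cBar n p ↔ 5 ≤ p := by
  have h : (p : ℝ) + 2 < n := by exact_mod_cast hnp
  have hn : (0 : ℝ) < n := by exact_mod_cast (by omega : 0 < n)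
  have hd : 0 < ((n : ℝ) - p) * ((n : ℝ) - p + 2) := mul_pos (by linarith) (by linarith)
  rw [cBar, div_pos_iff_of_pos_right hd, mul_pos_iff_of_pos_left (by positivity), sub_pos]
  constructor
  · intro h4
    have : 4 < p := by exact_mod_cast h4
    omega
  · intro h5
    have : 4 < p := by omega
    exact_mod_cast this

end Domination

end LinReg

theorem mainTheorem2 (n p : ℕ) (hnp : p + 2 < n) (X : Matrix (Fin n) (Fin p) ℝ)
    (hX : X.rank = p) :
    (0 < LinReg.cBar n p ↔ 5 ≤ p) ∧
    (0 < LinReg.cBar n p →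
      LinReg.Inadmissible X (LinReg.AICc X) ∧
      ∀ c : ℝ, 0 < c → c ≤ LinReg.cBar n p →
        LinReg.DominatesInDifference X (LinReg.MAICc X c) (LinReg.AICc X) ∧
        (p + 4 < n → LinReg.Dominates X (LinReg.MAICc X c) (LinReg.AICc X))) := by
  refine ⟨LinReg.cBar_pos_iff hnp, fun hpos => ?_⟩
  have hp := (LinReg.cBar_pos_iff hnp).1 hpos
  refine ⟨LinReg.inadmissible_AICc hX hnp hp hpos, fun c hc hcb => ⟨⟨fun β s hs => ?_, ?_⟩, ?_⟩⟩
  · have h := LinReg.errorDiff_law hX hnp c hp hc hcb β hs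
    exact ⟨h.1, h.2.le⟩
  -- The choice `(0, 1)` is arbitrary, since the expectation is negative at every parameter.
  · exact ⟨0, 1, one_pos, (LinReg.errorDiff_law hX hnp c hp hc hcb 0 one_pos).2⟩
  · exact fun hn4 => LinReg.dominates_MAICc_of_risk_ne_top hX hnp hp hc hcb
      ⟨0, 1, one_pos, LinReg.risk_AICc_ne_top hX hnp hn4 0 one_pos⟩
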